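/- Let $(\mathcal{C},\mathbb{E},\mathfrak{s})$ be an extriangulated category (in the sense of Nakaoka and Palu) with enough projectives $\mathcal{P}$ and enough injectives. For an object $X$ choose an $\mathfrak{s}$-triangle $\Omega X\to P\to X\dashrightarrow$ with $P\in\mathcal{P}$, put $\Omega^{0}X=X$ and $\Omega^{i}X=\Omega(\Omega^{i-1}X)$, and for $i\ge 1$ let $\mathbb{E}^{i}(X,Y)=\mathbb{E}(\Omega^{i-1}X,Y)$; up to isomorphism it does not depend on the choices, and $\mathbb{E}^1=\mathbb{E}$. For a full subcategory $\mathcal{M}$ of $\mathcal{C}$ and an integer $m\ge 0$ put $${}^{\bot_{m}}\mathcal{M}=\{X\in\mathcal{C}\mid \mathbb{E}^i(X,M)=0\text{ for all }M\in\mathcal{M},\ 1\le i\le m\},$$ $$\mathcal{M}^{\bot_{m}}=\{X\in\mathcal{C}\mid \mathbb{E}^i(M,X)=0\text{ for all }M\in\mathcal{M},\ 1\le i\le m\}.$$ Let $n\ge 2$. The subcategory $\mathcal{M}$ is called $n$-cluster tilting if it is functorially finite in $\mathcal{C}$ (every object of $\mathcal{C}$ has a left and a right $\mathcal{M}$-approximation),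 and for every object $X$ of $\mathcal{C}$ both $$X\in\mathcal{M}\iff X\in{}^{\bot_{n-1}}\mathcal{M}\qquad\text{and}\qquad X\in\mathcal{M}\iff X\in\mathcal{M}^{\bot_{n-1}}.$$ Let $\mathcal{M}_L$ be the full subcategory of the objects $X$ that admit an $\mathfrak{s}$-triangle $X\to M'\to M''\dashrightarrow$ with $M',M''\in\mathcal{M}$, and $\mathcal{M}_R$ the full subcategory of the objects $X$ that admit an $\mathfrak{s}$-triangle $M'\to M''\to X\dashrightarrow$ with $M',M''\in\mathcal{M}$. If $\mathcal{M}$ is an $n$-cluster tilting subcategory of $\mathcal{C}$, then $$\mathcal{M}_L={}^{\bot_{n-2}}\mathcal{M}\qquad\text{and}\qquad \mathcal{M}_R=\mathcal{M}^{\bot_{n-2}}.$$ In particular, $\mathcal{M}_L=\mathcal{M}_R=\mathcal{C}$ when $n=2$. -/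

import Mathlib

open CategoryTheory CategoryTheory.Limits Opposite

universe w v u

namespace Extri

section Extensions

variable {C : Type u} [Category.{v} C] (E : Cᵒᵖ ⥤ C ⥤ AddCommGrpCat.{w})

/-- The abelian group `𝔼(Z, A)` of `𝔼`-extensions. -/
abbrev Ext (Z A : C) : Type w := (E.obj (op Z)).obj A

variable {E}

/-- The extension `a_* δ`. -/
def push {Z A A' : C} (a : A ⟶ A') (δ : Ext E Z A) : Ext E Z A' :=
  ((E.obj (op Z)).map a).hom δ

/-- The extension `c^* δ`. -/
def pull {Z Z' A : C} (c : Z' ⟶ Z) (δ : Ext E Z A) : Ext E Z' A :=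
  ((E.map c.op).app A).hom δ

/-- The extension `δ ⊕ δ'`, the element of `𝔼(Z ⊞ Z', A ⊞ A')` with the four components
`(δ, 0, 0, δ')`. -/
noncomputable def directSum [Preadditive C] [HasBinaryBiproducts C] {Z A Z' A' : C}
    (δ : Ext E Z A) (δ' : Ext E Z' A') : Ext E (Z ⊞ Z') (A ⊞ A') :=
  push (biprod.inl : A ⟶ A ⊞ A') (pull (biprod.fst : Z ⊞ Z' ⟶ Z) δ) +
    push (biprod.inr : A' ⟶ A ⊞ A') (pull (biprod.snd : Z ⊞ Z' ⟶ Z') δ')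

end Extensions

section Sequences

variable {C : Type u} [Category.{v} C]

/-- A sequence of two morphisms `A ⟶ B ⟶ Z` with prescribed ends `A` and `Z`. -/
structure Seq (A Z : C) where
  {B : C}
  x : A ⟶ B
  y : B ⟶ Z

/-- Two sequences with the same ends are equivalent if there is an isomorphism of the middle terms
which is compatible with the identities of the ends. -/
def seqSetoid (A Z : C) : Setoid (Seq A Z) where
  r S S' := ∃ b : S.B ≅ S'.B, S.x ≫ b.hom = S'.x ∧ b.hom ≫ S'.y = S.y
  iseqv :=
    { refl := fun S => ⟨Iso.refl _, by simp, by simp⟩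
      symm := by
        rintro S S' ⟨b, h₁, h₂⟩
        exact ⟨b.symm, by simp [← h₁], by simp [← h₂]⟩
      trans := by
        rintro S S' S'' ⟨b, h₁, h₂⟩ ⟨b', h₁', h₂'⟩
        exact ⟨b ≪≫ b', by simp [← h₁', ← h₁], by simp [h₂', h₂]⟩ }

/-- Equivalence classes of sequences `A ⟶ B ⟶ Z`. -/
abbrev SeqClass (A Z : C) : Type (max u v) := Quotient (seqSetoid A Z)

/-- The equivalence class `[A ⟶ B ⟶ Z]`. -/
def seqClass {A B Z : C} (x : A ⟶ B) (y : B ⟶ Z) : SeqClass A Z :=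
  Quotient.mk (seqSetoid A Z) ⟨x, y⟩

end Sequences

/-- The data and axioms turning an additive category into an extriangulated category
`(C, 𝔼, 𝔰)`. -/
structure ExtriangulatedStructure (C : Type u) [Category.{v} C] [Preadditive C] [HasZeroObject C]
    [HasBinaryBiproducts C] where
  /-- the bifunctor `𝔼` -/
  E : Cᵒᵖ ⥤ C ⥤ AddCommGrpCat.{w}
  additive_left : E.Additive
  additive_right (Z : Cᵒᵖ) : (E.obj Z).Additive
  /-- the correspondence `𝔰` -/
  s : ∀ {Z A : C}, Ext E Z A → SeqClass A Z
  /-- morphisms of extensions are realized by morphisms of sequences -/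
  exists_realization : ∀ {A B Z A' B' Z' : C} (x : A ⟶ B) (y : B ⟶ Z) (δ : Ext E Z A)
    (x' : A' ⟶ B') (y' : B' ⟶ Z') (δ' : Ext E Z' A') (a : A ⟶ A') (c : Z ⟶ Z'),
    s δ = seqClass x y → s δ' = seqClass x' y' → push a δ = pull c δ' →
    ∃ b : B ⟶ B', x ≫ b = a ≫ x' ∧ y ≫ c = b ≫ y'
  s_zero : ∀ Z A : C, s (0 : Ext E Z A) =
    seqClass (biprod.inl : A ⟶ A ⊞ Z) (biprod.snd : A ⊞ Z ⟶ Z)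
  s_directSum : ∀ {A B Z A' B' Z' : C} (x : A ⟶ B) (y : B ⟶ Z) (δ : Ext E Z A)
    (x' : A' ⟶ B') (y' : B' ⟶ Z') (δ' : Ext E Z' A'),
    s δ = seqClass x y → s δ' = seqClass x' y' →
    s (directSum δ δ') = seqClass (biprod.map x x') (biprod.map y y')
  et3 : ∀ {A B Z A' B' Z' : C} (x : A ⟶ B) (y : B ⟶ Z) (δ : Ext E Z A)
    (x' : A' ⟶ B') (y' : B' ⟶ Z') (δ' : Ext E Z' A') (a : A ⟶ A') (b : B ⟶ B'),
    s δ = seqClass x y → s δ' = seqClass x' y' → x ≫ b = a ≫ x' →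
    ∃ c : Z ⟶ Z', y ≫ c = b ≫ y' ∧ push a δ = pull c δ'
  et3_op : ∀ {A B Z A' B' Z' : C} (x : A ⟶ B) (y : B ⟶ Z) (δ : Ext E Z A)
    (x' : A' ⟶ B') (y' : B' ⟶ Z') (δ' : Ext E Z' A') (b : B ⟶ B') (c : Z ⟶ Z'),
    s δ = seqClass x y → s δ' = seqClass x' y' → y ≫ c = b ≫ y' →
    ∃ a : A ⟶ A', x ≫ b = a ≫ x' ∧ push a δ = pull c δ'
  et4 : ∀ {A B D G F : C} (f : A ⟶ B) (f' : B ⟶ D) (δ : Ext E D A)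
    (g : B ⟶ G) (g' : G ⟶ F) (δ' : Ext E F B),
    s δ = seqClass f f' → s δ' = seqClass g g' →
    ∃ (H : C) (d : D ⟶ H) (e : H ⟶ F) (h : A ⟶ G) (h' : G ⟶ H) (δ'' : Ext E H A),
      f ≫ g = h ∧ f' ≫ d = g ≫ h' ∧ h' ≫ e = g' ∧
      s δ'' = seqClass h h' ∧ s (push f' δ') = seqClass d e ∧
      δ = pull d δ'' ∧ push f δ'' = pull e δ'
  et4_op : ∀ {D A B F G : C} (f' : D ⟶ A) (f : A ⟶ B) (δ : Ext E B D)
    (g' : F ⟶ B) (g : B ⟶ G) (δ' : Ext E G F),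
    s δ = seqClass f' f → s δ' = seqClass g' g →
    ∃ (H : C) (d : D ⟶ H) (e : H ⟶ F) (h' : H ⟶ A) (h : A ⟶ G) (δ'' : Ext E G H),
      d ≫ h' = f' ∧ h' ≫ f = e ≫ g' ∧ f ≫ g = h ∧
      s (pull g' δ) = seqClass d e ∧ s δ'' = seqClass h' h ∧
      δ' = push e δ'' ∧ push d δ = pull g δ''

namespace ExtriangulatedStructure

variable {C : Type u} [Category.{v} C] [Preadditive C] [HasZeroObject C] [HasBinaryBiproducts C]
  (T : ExtriangulatedStructure.{w} C)

/-- `A ⟶ B ⟶ Z ⇢` (with extension `δ`) is an `𝔰`-triangle. -/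
def IsTriangle {A B Z : C} (x : A ⟶ B) (y : B ⟶ Z) (δ : Ext T.E Z A) : Prop :=
  T.s δ = seqClass x y

/-- `A ⟶ B ⟶ Z` is an `𝔰`-conflation. -/
def IsConflation {A B Z : C} (x : A ⟶ B) (y : B ⟶ Z) : Prop :=
  ∃ δ : Ext T.E Z A, T.IsTriangle x y δ

def IsInflation {A B : C} (x : A ⟶ B) : Prop :=
  ∃ (Z : C) (y : B ⟶ Z), T.IsConflation x y

def IsDeflation {B Z : C} (y : B ⟶ Z) : Prop :=
  ∃ (A : C) (x : A ⟶ B), T.IsConflation x y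

/-- The full subcategory `𝒫` of projective objects. -/
def projectives : ObjectProperty C := fun P =>
  ∀ ⦃B Z : C⦄ (y : B ⟶ Z), T.IsDeflation y → ∀ c : P ⟶ Z, ∃ b : P ⟶ B, b ≫ y = c

/-- The full subcategory `ℐ` of injective objects. -/
def injectives : ObjectProperty C := fun I =>
  ∀ ⦃A B : C⦄ (x : A ⟶ B), T.IsInflation x → ∀ a : A ⟶ I, ∃ b : B ⟶ I, x ≫ b = a

def EnoughProjectives : Prop :=
  ∀ Z : C, ∃ (A P : C) (x : A ⟶ P) (y : P ⟶ Z), T.projectives P ∧ T.IsConflation x y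

def EnoughInjectives : Prop :=
  ∀ A : C, ∃ (I Z : C) (x : A ⟶ I) (y : I ⟶ Z), T.injectives I ∧ T.IsConflation x y

variable {T} in
/-- A syzygy `Ω X`: the first term of a chosen `𝔰`-triangle `Ω X ⟶ P ⟶ X ⇢` with `P`
projective. -/
noncomputable def EnoughProjectives.syzygy (hP : T.EnoughProjectives) (X : C) : C :=
  (hP X).choose

/-- For `i ≥ 1`, the higher extension group `𝔼ⁱ(X, Y) = 𝔼(Ωⁱ⁻¹ X, Y)`; in particular
`𝔼¹ = 𝔼`. The value at `i = 0` is never used. -/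
noncomputable def higherExt (hP : T.EnoughProjectives) (i : ℕ) (X Y : C) : Type w :=
  Ext T.E (hP.syzygy^[i - 1] X) Y

/-- The objects `X` with `𝔼ⁱ(X, M) = 0` for all `M` in `M` and `1 ≤ i ≤ m`. -/
def leftPerp (hP : T.EnoughProjectives) (m : ℕ) (M : ObjectProperty C) : ObjectProperty C :=
  fun X => ∀ i : ℕ, 1 ≤ i → i ≤ m → ∀ Y : C, M Y → Subsingleton (T.higherExt hP i X Y)

/-- The objects `X` with `𝔼ⁱ(M, X) = 0` for all `M` in `M` and `1 ≤ i ≤ m`. -/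
def rightPerp (hP : T.EnoughProjectives) (m : ℕ) (M : ObjectProperty C) : ObjectProperty C :=
  fun X => ∀ i : ℕ, 1 ≤ i → i ≤ m → ∀ Y : C, M Y → Subsingleton (T.higherExt hP i Y X)

/-- `Cocone(M', M'')`: objects `X` admitting an `𝔰`-triangle `X ⟶ Y' ⟶ Y'' ⇢` with `Y'` in `M'`
and `Y''` in `M''`. -/
def cocone (M' M'' : ObjectProperty C) : ObjectProperty C := fun X =>
  ∃ (Y' Y'' : C) (x : X ⟶ Y') (y : Y' ⟶ Y''), M' Y' ∧ M'' Y'' ∧ T.IsConflation x y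

/-- `Cone(M', M'')`: objects `X` admitting an `𝔰`-triangle `Y' ⟶ Y'' ⟶ X ⇢` with `Y'` in `M'`
and `Y''` in `M''`. -/
def cone (M' M'' : ObjectProperty C) : ObjectProperty C := fun X =>
  ∃ (Y' Y'' : C) (x : Y' ⟶ Y'') (y : Y'' ⟶ X), M' Y' ∧ M'' Y'' ∧ T.IsConflation x y

end ExtriangulatedStructure

section FunctoriallyFinite

variable {C : Type u} [Category.{v} C]

/-- `f : X ⟶ Y` is a left `M`-approximation of `X`. -/
def IsLeftApprox (M : ObjectProperty C) {X Y : C} (f : X ⟶ Y) : Prop :=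
  M Y ∧ ∀ ⦃Y' : C⦄, M Y' → ∀ g : X ⟶ Y', ∃ h : Y ⟶ Y', f ≫ h = g

/-- `f : Y ⟶ X` is a right `M`-approximation of `X`. -/
def IsRightApprox (M : ObjectProperty C) {X Y : C} (f : Y ⟶ X) : Prop :=
  M Y ∧ ∀ ⦃Y' : C⦄, M Y' → ∀ g : Y' ⟶ X, ∃ h : Y' ⟶ Y, h ≫ f = g

/-- `M` is functorially finite: every object has a left and a right `M`-approximation. -/
def FunctoriallyFinite (M : ObjectProperty C) : Prop :=
  (∀ X : C, ∃ (Y : C) (f : X ⟶ Y), IsLeftApprox M f) ∧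
    (∀ X : C, ∃ (Y : C) (f : Y ⟶ X), IsRightApprox M f)

end FunctoriallyFinite

namespace ExtriangulatedStructure

variable {C : Type u} [Category.{v} C] [Preadditive C] [HasZeroObject C] [HasBinaryBiproducts C]
  (T : ExtriangulatedStructure.{w} C)

/-- `M` is an `n`-cluster tilting subcategory (where `n ≥ 2`). -/
structure IsClusterTilting (hP : T.EnoughProjectives) (n : ℕ) (M : ObjectProperty C) : Prop where
  functoriallyFinite : FunctoriallyFinite M
  mem_iff_left (X : C) : M X ↔ T.leftPerp hP (n - 1) M X
  mem_iff_right (X : C) : M X ↔ T.rightPerp hP (n - 1) M X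

end ExtriangulatedStructure

end Extri

namespace Extri

/-! ### Functoriality of extensions. -/

section Extensions

variable {C : Type u} [Category.{v} C] {E : Cᵒᵖ ⥤ C ⥤ AddCommGrpCat.{w}}

/-! The proof is dimension shifting without long exact sequences. Given conflations `A ⟶ B ⟶ Z` and
`K ⟶ P ⟶ W`, vanishing passes between `𝔼(W, Z)` and `𝔼(K, A)` when suitable side groups vanish
(`subsingleton_ext_left`, `subsingleton_ext_right`). Write `Σ` for cosyzygies. For `X ⟶ Y' ⟶ Y''`
with `Y'` in `M`, this compares `𝔼(X, Σᵏ N)` with `𝔼(Y'', Σᵏ⁺¹ N)`, so `Y''` satisfies one more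
vanishing condition than `X`. Conversely, a left approximation of `X` can be made an inflation by
adding an injective; the approximation property gives `𝔼(Y'', N) = 0`, the shift gives the rest, and
cluster tilting puts `Y''` in `M`. The statement for `M_R` is dual. -/

@[simp]
lemma push_id {Z A : C} (δ : Ext E Z A) : push (𝟙 A) δ = δ := by
  simp [push]

@[simp]
lemma pull_id {Z A : C} (δ : Ext E Z A) : pull (𝟙 Z) δ = δ := by
  simp [pull]

@[simp]
lemma push_zero {Z A A' : C} (a : A ⟶ A') : push a (0 : Ext E Z A) = 0 :=
  map_zero ((E.obj (op Z)).map a).hom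

@[simp]
lemma pull_zero {Z Z' A : C} (c : Z' ⟶ Z) : pull c (0 : Ext E Z A) = 0 :=
  map_zero ((E.map c.op).app A).hom

lemma push_comp {Z A A' A'' : C} (a : A ⟶ A') (a' : A' ⟶ A'') (δ : Ext E Z A) :
    push (a ≫ a') δ = push a' (push a δ) := by
  simp [push]

lemma pull_comp {Z Z' Z'' A : C} (c' : Z'' ⟶ Z') (c : Z' ⟶ Z) (δ : Ext E Z A) :
    pull (c' ≫ c) δ = pull c' (pull c δ) := by
  simp [pull]

end Extensions

lemma seqClass_eq {C : Type u} [Category.{v} C] {A B B' Z : C} {x : A ⟶ B} {y : B ⟶ Z}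
    {x' : A ⟶ B'} {y' : B' ⟶ Z} (b : B ≅ B') (hx : x ≫ b.hom = x') (hy : b.hom ≫ y' = y) :
    seqClass x y = seqClass x' y' :=
  Quotient.sound ⟨b, hx, hy⟩

namespace ExtriangulatedStructure

variable {C : Type u} [Category.{v} C] [Preadditive C] [HasZeroObject C] [HasBinaryBiproducts C]
  {T : ExtriangulatedStructure.{w} C}

lemma exists_isTriangle {Z A : C} (δ : Ext T.E Z A) :
    ∃ (B : C) (x : A ⟶ B) (y : B ⟶ Z), T.IsTriangle x y δ := by
  obtain ⟨S, hS⟩ := Quotient.exists_rep (T.s δ)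
  exact ⟨S.B, S.x, S.y, hS.symm⟩

/-! ### Exactness of the Hom–`𝔼` sequences. -/

section Exactness

variable {A B Z : C} {x : A ⟶ B} {y : B ⟶ Z} {δ : Ext T.E Z A}

lemma IsTriangle.push_eq_zero (h : T.IsTriangle x y δ) : push x δ = 0 := by
  obtain ⟨c, -, hc⟩ := T.et3 _ _ _ _ _ _ x biprod.inl h (T.s_zero Z B) rfl
  simpa using hc

lemma IsTriangle.pull_eq_zero (h : T.IsTriangle x y δ) : pull y δ = 0 := by
  obtain ⟨a, -, ha⟩ := T.et3_op _ _ _ _ _ _ biprod.snd y (T.s_zero B A) h rfl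
  simpa using ha.symm

/-- Map the split triangle realizing `0` to the given one, then restrict to the summand `W`. -/
lemma IsTriangle.exists_lift (h : T.IsTriangle x y δ) {W : C} (g : W ⟶ Z) (hg : pull g δ = 0) :
    ∃ f : W ⟶ B, f ≫ y = g := by
  obtain ⟨b, -, hb⟩ := T.exists_realization _ _ _ _ _ _ (𝟙 A) g (T.s_zero W A) h
    (by rw [hg, push_zero])
  exact ⟨biprod.inr ≫ b, by rw [Category.assoc, ← hb]; simp⟩

lemma IsTriangle.exists_desc (h : T.IsTriangle x y δ) {Y : C} (g : A ⟶ Y) (hg : push g δ = 0) :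
    ∃ f : B ⟶ Y, x ≫ f = g := by
  obtain ⟨b, hb, -⟩ := T.exists_realization _ _ _ _ _ _ g (𝟙 Z) h (T.s_zero Z Y)
    (by rw [hg, pull_zero])
  exact ⟨b ≫ biprod.fst, by rw [← Category.assoc, hb]; simp⟩

lemma IsTriangle.exists_eq_pull (h : T.IsTriangle x y δ) {W : C} (θ : Ext T.E W A)
    (hθ : push x θ = 0) : ∃ g : W ⟶ Z, θ = pull g δ := by
  obtain ⟨D, x', y', h'⟩ := exists_isTriangle θ
  obtain ⟨f, hf⟩ := h'.exists_desc x hθ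
  obtain ⟨c, -, hc⟩ := T.et3 _ _ _ _ _ _ (𝟙 A) f h' h (by simpa using hf)
  exact ⟨c, by simpa using hc⟩

lemma IsTriangle.exists_eq_push (h : T.IsTriangle x y δ) {Y : C} (θ : Ext T.E Z Y)
    (hθ : pull y θ = 0) : ∃ g : A ⟶ Y, θ = push g δ := by
  obtain ⟨D, x', y', h'⟩ := exists_isTriangle θ
  obtain ⟨f, hf⟩ := h'.exists_lift y hθ
  obtain ⟨a, -, ha⟩ := T.et3_op _ _ _ _ _ _ f (𝟙 Z) h h' (by simpa using hf.symm)
  exact ⟨a, by simpa using ha.symm⟩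

end Exactness

lemma subsingleton_ext_of_projectives {P : C} (hP : T.projectives P) (A : C) :
    Subsingleton (Ext T.E P A) := by
  refine subsingleton_of_forall_eq 0 fun θ => ?_
  obtain ⟨D, x, y, h⟩ := exists_isTriangle θ
  obtain ⟨b, hb⟩ := hP y ⟨A, x, θ, h⟩ (𝟙 P)
  rw [← pull_id θ, ← hb, pull_comp, h.pull_eq_zero, pull_zero]

lemma subsingleton_ext_of_injectives {I : C} (hI : T.injectives I) (Z : C) :
    Subsingleton (Ext T.E Z I) := by
  refine subsingleton_of_forall_eq 0 fun θ => ?_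
  obtain ⟨D, x, y, h⟩ := exists_isTriangle θ
  obtain ⟨b, hb⟩ := hI x ⟨Z, y, θ, h⟩ (𝟙 I)
  rw [← push_id θ, ← hb, push_comp, h.push_eq_zero, push_zero]

/-- Along conflations `A ⟶ B ⟶ Z` and `K ⟶ P ⟶ W`, vanishing of `𝔼(W, Z)` gives vanishing of
`𝔼(K, A)`. -/
lemma subsingleton_ext_left {A B Z K P W : C} {x : A ⟶ B} {y : B ⟶ Z} {k : K ⟶ P} {p : P ⟶ W}
    (h : T.IsConflation x y) (h' : T.IsConflation k p) (hWZ : Subsingleton (Ext T.E W Z))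
    (hKB : Subsingleton (Ext T.E K B)) (hPA : Subsingleton (Ext T.E P A)) :
    Subsingleton (Ext T.E K A) := by
  obtain ⟨δ, h⟩ := h
  obtain ⟨ω, h'⟩ := h'
  refine subsingleton_of_forall_eq 0 fun θ => ?_
  obtain ⟨g, rfl⟩ := h.exists_eq_pull θ (Subsingleton.elim _ _)
  obtain ⟨f, rfl⟩ := h'.exists_desc g (Subsingleton.elim _ _)
  rw [pull_comp, Subsingleton.elim (pull f δ) 0, pull_zero]

/-- Along conflations `A ⟶ B ⟶ Z` and `K ⟶ P ⟶ W`, vanishing of `𝔼(K, A)` gives vanishing of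
`𝔼(W, Z)`. -/
lemma subsingleton_ext_right {A B Z K P W : C} {x : A ⟶ B} {y : B ⟶ Z} {k : K ⟶ P} {p : P ⟶ W}
    (h : T.IsConflation x y) (h' : T.IsConflation k p) (hKA : Subsingleton (Ext T.E K A))
    (hWB : Subsingleton (Ext T.E W B)) (hPZ : Subsingleton (Ext T.E P Z)) :
    Subsingleton (Ext T.E W Z) := by
  obtain ⟨δ, h⟩ := h
  obtain ⟨ω, h'⟩ := h'
  refine subsingleton_of_forall_eq 0 fun θ => ?_
  obtain ⟨g, rfl⟩ := h'.exists_eq_push θ (Subsingleton.elim _ _)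
  obtain ⟨f, rfl⟩ := h.exists_lift g (Subsingleton.elim _ _)
  rw [push_comp, Subsingleton.elim (push f ω) 0, push_zero]

/-! ### Syzygies against cosyzygies. -/

lemma EnoughProjectives.exists_syzygy_isConflation (hP : T.EnoughProjectives) (X : C) :
    ∃ (P : C) (x : hP.syzygy X ⟶ P) (y : P ⟶ X), T.projectives P ∧ T.IsConflation x y :=
  (hP X).choose_spec

/-- A cosyzygy `Σ X`: the last term of a chosen `𝔰`-triangle `X ⟶ I ⟶ Σ X ⇢` with `I`
injective. -/
noncomputable def EnoughInjectives.cosyzygy (hI : T.EnoughInjectives) (X : C) : C :=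
  (hI X).choose_spec.choose

lemma EnoughInjectives.exists_cosyzygy_isConflation (hI : T.EnoughInjectives) (X : C) :
    ∃ (I : C) (x : X ⟶ I) (y : I ⟶ hI.cosyzygy X), T.injectives I ∧ T.IsConflation x y :=
  ⟨_, (hI X).choose_spec.choose_spec⟩

lemma subsingleton_ext_syzygy_iff (hP : T.EnoughProjectives) (hI : T.EnoughInjectives) (X Y : C) :
    Subsingleton (Ext T.E (hP.syzygy X) Y) ↔ Subsingleton (Ext T.E X (hI.cosyzygy Y)) := by
  obtain ⟨P, k, p, hPP, hp⟩ := hP.exists_syzygy_isConflation X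
  obtain ⟨I, x, y, hII, hy⟩ := hI.exists_cosyzygy_isConflation Y
  exact ⟨fun h => subsingleton_ext_right hy hp h (subsingleton_ext_of_injectives hII _)
      (subsingleton_ext_of_projectives hPP _),
    fun h => subsingleton_ext_left hy hp h (subsingleton_ext_of_injectives hII _)
      (subsingleton_ext_of_projectives hPP _)⟩

lemma subsingleton_ext_syzygy_iterate_iff (hP : T.EnoughProjectives) (hI : T.EnoughInjectives)
    (k : ℕ) (X Y : C) :
    Subsingleton (Ext T.E (hP.syzygy^[k] X) Y) ↔
      Subsingleton (Ext T.E X (hI.cosyzygy^[k] Y)) := by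
  induction k generalizing Y with
  | zero => rfl
  | succ k ih =>
    -- The outermost syzygy becomes the innermost cosyzygy, hence the induction over all `Y`.
    rw [Function.iterate_succ_apply', Function.iterate_succ_apply,
      subsingleton_ext_syzygy_iff hP hI, ih]

lemma rightPerp_iff (hP : T.EnoughProjectives) (m : ℕ) (M : ObjectProperty C) (X : C) :
    T.rightPerp hP m M X ↔
      ∀ k < m, ∀ Y, M Y → Subsingleton (Ext T.E (hP.syzygy^[k] Y) X) := by
  refine ⟨fun h k hk Y hY => h (k + 1) (by omega) (by omega) Y hY, fun h i hi him Y hY => ?_⟩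
  exact h (i - 1) (by omega) Y hY

/-- With `k = i - 1`, all shifts move to the second variable, so a conflation starting at `X` can be
used without taking its syzygies. -/
lemma leftPerp_iff (hP : T.EnoughProjectives) (hI : T.EnoughInjectives) (m : ℕ)
    (M : ObjectProperty C) (X : C) :
    T.leftPerp hP m M X ↔
      ∀ k < m, ∀ Y, M Y → Subsingleton (Ext T.E X (hI.cosyzygy^[k] Y)) := by
  simp only [← subsingleton_ext_syzygy_iterate_iff hP hI]
  refine ⟨fun h k hk Y hY => h (k + 1) (by omega) (by omega) Y hY, fun h i hi him Y hY => ?_⟩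
  exact h (i - 1) (by omega) Y hY

lemma subsingleton_ext_biprod {Z A B : C} (hA : Subsingleton (Ext T.E Z A))
    (hB : Subsingleton (Ext T.E Z B)) : Subsingleton (Ext T.E Z (A ⊞ B)) := by
  have := T.additive_right (op Z)
  refine subsingleton_of_forall_eq 0 fun θ => ?_
  have hadd : push (biprod.fst ≫ biprod.inl + biprod.snd ≫ biprod.inr : A ⊞ B ⟶ A ⊞ B) θ =
      push (biprod.fst ≫ biprod.inl) θ + push (biprod.snd ≫ biprod.inr) θ := by
    simp only [push, Functor.map_add, AddCommGrpCat.hom_add]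
    rfl
  rw [biprod.total, push_id, push_comp, push_comp, Subsingleton.elim (push biprod.fst θ) 0,
    Subsingleton.elim (push biprod.snd θ) 0] at hadd
  simpa using hadd

/-! ### Split triangles and enlarged inflations and deflations. -/

lemma isTriangle_id_left (Y : C) {O : C} (hO : IsZero O) : T.IsTriangle (𝟙 Y) (0 : Y ⟶ O) 0 :=
  (T.s_zero O Y).trans (seqClass_eq
    { hom := biprod.fst
      inv := biprod.inl
      hom_inv_id := biprod.hom_ext' _ _ (by simp) (hO.eq_of_src _ _) } (by simp)
    (hO.eq_of_tgt _ _))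

lemma isTriangle_id_right (Y : C) {O : C} (hO : IsZero O) : T.IsTriangle (0 : O ⟶ Y) (𝟙 Y) 0 :=
  (T.s_zero Y O).trans (seqClass_eq
    { hom := biprod.snd
      inv := biprod.inr
      hom_inv_id := biprod.hom_ext' _ _ (hO.eq_of_src _ _) (by simp) }
    (hO.eq_of_src _ _) (by simp))

lemma isTriangle_graph {A Y : C} (a : A ⟶ Y) :
    T.IsTriangle (biprod.lift (𝟙 A) a) (biprod.desc (-a) (𝟙 Y)) 0 :=
  (T.s_zero Y A).trans (seqClass_eq
    { hom := biprod.desc (biprod.lift (𝟙 A) a) biprod.inr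
      inv := biprod.desc (biprod.lift (𝟙 A) (-a)) biprod.inr
      hom_inv_id := by ext <;> simp
      inv_hom_id := by ext <;> simp } (by simp) (by ext <;> simp))

lemma isTriangle_cograph {W Z : C} (c : W ⟶ Z) :
    T.IsTriangle (biprod.lift (-c) (𝟙 W)) (biprod.desc (𝟙 Z) c) 0 :=
  (T.s_zero Z W).trans (seqClass_eq
    { hom := biprod.desc (biprod.lift (-c) (𝟙 W)) biprod.inl
      inv := biprod.desc biprod.inr (biprod.lift (𝟙 W) c)
      hom_inv_id := by ext <;> simp
      inv_hom_id := by ext <;> simp } (by simp) (by ext <;> simp))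

/-- The map is the graph of `a`, a split inflation, followed by `x ⊕ 𝟙`; (ET4) composes inflations.
-/
lemma IsInflation.biprod_lift {A B Y : C} {x : A ⟶ B} (hx : T.IsInflation x) (a : A ⟶ Y) :
    T.IsInflation (biprod.lift x a) := by
  obtain ⟨Z, y, δ, h⟩ := hx
  obtain ⟨H, d, e, f, f', δ'', hf, -, -, hδ, -⟩ := T.et4 _ _ _ _ _ _ (isTriangle_graph a)
    (T.s_directSum _ _ _ _ _ _ h (isTriangle_id_left Y (isZero_zero C)))
  refine ⟨H, f', δ'', ?_⟩
  rwa [← hf, show biprod.lift (𝟙 A) a ≫ biprod.map x (𝟙 Y) = biprod.lift x a by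
    ext <;> simp] at hδ

lemma IsDeflation.biprod_desc {B Z W : C} {y : B ⟶ Z} (hy : T.IsDeflation y) (c : W ⟶ Z) :
    T.IsDeflation (biprod.desc y c) := by
  obtain ⟨A, x, δ, h⟩ := hy
  obtain ⟨H, d, e, f', f, δ'', -, -, hf, -, hδ, -⟩ := T.et4_op _ _ _ _ _ _
    (T.s_directSum _ _ _ _ _ _ h (isTriangle_id_right W (isZero_zero C))) (isTriangle_cograph c)
  refine ⟨H, f', δ'', ?_⟩
  rwa [← hf, show biprod.map y (𝟙 W) ≫ biprod.desc (𝟙 Z) c = biprod.desc y c by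
    ext <;> simp] at hδ

/-! ### Cluster tilting subcategories. -/

namespace IsClusterTilting

variable {hP : T.EnoughProjectives} {n : ℕ} {M : ObjectProperty C}

lemma of_injectives (hM : T.IsClusterTilting hP n M) {I : C} (hI : T.injectives I) : M I :=
  (hM.mem_iff_right I).2 fun _ _ _ _ _ => subsingleton_ext_of_injectives hI _

lemma of_projectives (hM : T.IsClusterTilting hP n M) (hI : T.EnoughInjectives) {P : C}
    (hPP : T.projectives P) : M P :=
  (hM.mem_iff_left P).2 ((leftPerp_iff hP hI _ _ _).2 fun _ _ _ _ =>
    subsingleton_ext_of_projectives hPP _)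

lemma biprod (hM : T.IsClusterTilting hP n M) {X Y : C} (hX : M X) (hY : M Y) : M (X ⊞ Y) :=
  (hM.mem_iff_right _).2 fun i h₁ h₂ N hN => subsingleton_ext_biprod
    ((hM.mem_iff_right X).1 hX i h₁ h₂ N hN) ((hM.mem_iff_right Y).1 hY i h₁ h₂ N hN)

lemma exists_isLeftApprox_isInflation (hM : T.IsClusterTilting hP n M) (hI : T.EnoughInjectives)
    (X : C) : ∃ (Y : C) (f : X ⟶ Y), IsLeftApprox M f ∧ T.IsInflation f := by
  obtain ⟨Y, f, hY, hf⟩ := hM.functoriallyFinite.1 X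
  obtain ⟨I, Z, x, y, hII, hx⟩ := hI X
  refine ⟨I ⊞ Y, biprod.lift x f, ⟨hM.biprod (hM.of_injectives hII) hY, fun Y' hY' g => ?_⟩,
    IsInflation.biprod_lift ⟨Z, y, hx⟩ f⟩
  obtain ⟨h, rfl⟩ := hf hY' g
  exact ⟨biprod.snd ≫ h, by simp⟩

lemma exists_isRightApprox_isDeflation (hM : T.IsClusterTilting hP n M) (hI : T.EnoughInjectives)
    (X : C) : ∃ (Y : C) (f : Y ⟶ X), IsRightApprox M f ∧ T.IsDeflation f := by
  obtain ⟨Y, f, hY, hf⟩ := hM.functoriallyFinite.2 X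
  obtain ⟨A, P, x, y, hPP, hy⟩ := hP X
  refine ⟨P ⊞ Y, biprod.desc y f, ⟨hM.biprod (hM.of_projectives hI hPP) hY, fun Y' hY' g => ?_⟩,
    IsDeflation.biprod_desc ⟨A, x, hy⟩ f⟩
  obtain ⟨h, rfl⟩ := hf hY' g
  exact ⟨h ≫ biprod.inr, by simp⟩

lemma cocone_eq_leftPerp (hM : T.IsClusterTilting hP n M) (hI : T.EnoughInjectives) (hn : 2 ≤ n) :
    T.cocone M M = T.leftPerp hP (n - 2) M := by
  have hL {X : C} (hX : M X) := (leftPerp_iff hP hI _ _ _).1 ((hM.mem_iff_left X).1 hX)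
  ext X
  rw [leftPerp_iff hP hI]
  constructor
  · rintro ⟨Y', Y'', x, y, hY', hY'', hxy⟩ k hk N hN
    obtain ⟨I, a, b, hII, hab⟩ := hI.exists_cosyzygy_isConflation (hI.cosyzygy^[k] N)
    refine subsingleton_ext_left hab hxy ?_ (subsingleton_ext_of_injectives hII _)
      (hL hY' k (by omega) N hN)
    rw [← Function.iterate_succ_apply' hI.cosyzygy]
    exact hL hY'' (k + 1) (by omega) N hN
  · intro hX
    obtain ⟨Y', x, ⟨hY', hx⟩, Y'', y, hxy⟩ := hM.exists_isLeftApprox_isInflation hI X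
    refine ⟨Y', Y'', x, y, hY', (hM.mem_iff_left _).2 ((leftPerp_iff hP hI _ _ _).2 ?_), hxy⟩
    rintro (_ | k) hk N hN
    -- An extension of `Y''` by `N` dies on `Y'`, so it is `push g δ` with `g : X ⟶ N`. As `g`
    -- factors through the approximation `x` and `push x δ = 0`, it vanishes.
    · rw [Function.iterate_zero, id]
      obtain ⟨δ, h⟩ := hxy
      have := hL hY' 0 (by omega) N hN
      refine subsingleton_of_forall_eq 0 fun θ => ?_
      obtain ⟨g, rfl⟩ := h.exists_eq_push θ (this.elim _ _)
      obtain ⟨f, rfl⟩ := hx hN g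
      rw [push_comp, h.push_eq_zero, push_zero]
    · obtain ⟨I, a, b, hII, hab⟩ := hI.exists_cosyzygy_isConflation (hI.cosyzygy^[k] N)
      have := hL hY' (k + 1) (by omega) N hN
      rw [Function.iterate_succ_apply'] at this ⊢
      exact subsingleton_ext_right hab hxy (hX k (by omega) N hN)
        (subsingleton_ext_of_injectives hII _) this

lemma cone_eq_rightPerp (hM : T.IsClusterTilting hP n M) (hI : T.EnoughInjectives) (hn : 2 ≤ n) :
    T.cone M M = T.rightPerp hP (n - 2) M := by
  have hR {X : C} (hX : M X) := (rightPerp_iff hP _ _ _).1 ((hM.mem_iff_right X).1 hX)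
  ext X
  rw [rightPerp_iff hP]
  constructor
  · rintro ⟨Y', Y'', x, y, hY', hY'', hxy⟩ k hk N hN
    obtain ⟨P, a, b, hPP, hab⟩ := hP.exists_syzygy_isConflation (hP.syzygy^[k] N)
    refine subsingleton_ext_right hxy hab ?_ (hR hY'' k (by omega) N hN)
      (subsingleton_ext_of_projectives hPP _)
    rw [← Function.iterate_succ_apply' hP.syzygy]
    exact hR hY' (k + 1) (by omega) N hN
  · intro hX
    obtain ⟨Y'', y, ⟨hY'', hy⟩, Y', x, hxy⟩ := hM.exists_isRightApprox_isDeflation hI X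
    refine ⟨Y', Y'', x, y, (hM.mem_iff_right _).2 ((rightPerp_iff hP _ _ _).2 ?_), hY'', hxy⟩
    rintro (_ | k) hk N hN
    · rw [Function.iterate_zero, id]
      obtain ⟨δ, h⟩ := hxy
      have := hR hY'' 0 (by omega) N hN
      refine subsingleton_of_forall_eq 0 fun θ => ?_
      obtain ⟨g, rfl⟩ := h.exists_eq_pull θ (this.elim _ _)
      obtain ⟨f, rfl⟩ := hy hN g
      rw [pull_comp, h.pull_eq_zero, pull_zero]
    · obtain ⟨P, a, b, hPP, hab⟩ := hP.exists_syzygy_isConflation (hP.syzygy^[k] N)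
      have := hR hY'' (k + 1) (by omega) N hN
      rw [Function.iterate_succ_apply'] at this ⊢
      exact subsingleton_ext_left hxy hab (hX k (by omega) N hN) this
        (subsingleton_ext_of_projectives hPP _)

end IsClusterTilting

end ExtriangulatedStructure

end Extri

theorem mainTheorem11 {C : Type u} [Category.{v} C] [Preadditive C] [HasZeroObject C]
    [HasBinaryBiproducts C] (T : Extri.ExtriangulatedStructure.{w} C)
    (hP : T.EnoughProjectives) (hI : T.EnoughInjectives)
    (n : ℕ) (hn : 2 ≤ n) (M : ObjectProperty C) (hM : T.IsClusterTilting hP n M) :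
    T.cocone M M = T.leftPerp hP (n - 2) M ∧
      T.cone M M = T.rightPerp hP (n - 2) M ∧
      (n = 2 → T.cocone M M = ⊤ ∧ T.cone M M = ⊤) := by
  have hL := hM.cocone_eq_leftPerp hI hn
  have hR := hM.cone_eq_rightPerp hI hn
  refine ⟨hL, hR, ?_⟩
  rintro rfl
  rw [hL, hR]
  constructor <;> ext X <;>
    -- For `n = 2` the range `1 ≤ i ≤ 0` is empty.
    exact iff_of_true (fun i _ _ => by omega) trivial
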